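/- Let $S_0$ be a finite set and $\mathbb H=\{-1,0,1\}$. Let $P=(p_{y,y'})$ be a stochastic matrix on $\mathbb Z^3\times S_0$ (the transition matrix of a three-dimensional skip-free Markov-modulated random walk): $p_{(x,j),(x',j')}=0$ unless $x'-x\in\mathbb H^3$, and $p_{(x+k,j),(x'+k,j')}=p_{(x,j),(x',j')}$ for all $k\in\mathbb Z^3$. Put $A_k=(p_{(0,j),(k,j')})_{j,j'\in S_0}$ for $k\in\mathbb H^3$ and, for $z_1,z_2,z_3>0$, $$A_{***}(z_1,z_2,z_3)=\sum_{k\in\mathbb H^3}z_1^{k_1}z_2^{k_2}z_3^{k_3}A_k .$$ Let $Q=(p_{y,y'})_{y,y'\in\mathbb S_+}$ be the restriction of $P$ to $\mathbb S_+=\mathbb Z_+^3\times S_0$, and let $\tilde Q=(\tilde q_{y,y'})=\sum_{n\ge 0}Q^n$. Assume: 1. With $\pi$ the stationary distribution of $A_{***}(1,1,1)$, every component of the mean drift vector $a_i=\pi\big(\sum_{k\in\mathbb H^3:\,k_i=1}A_k-\sum_{k\in\mathbb H^3:\,k_i=-1}A_k\big)\mathbf 1$, $i=1,2,3$, is nonzero,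 and at least one of them is negative. 2. $Q$ is irreducible and aperiodic. 3. For each $i\in\{1,2,3\}$, every row of the block $A_1^{(i)}$ of $Q$ formed by the transitions that raise the $i$-th coordinate from $0$ to $1$ (rows and columns indexed by the other two coordinates in $\mathbb Z_+^2$ and the phase in $S_0$) has at least one positive entry. Let $\operatorname{spr}$ denote the spectral radius and, for $i=1,2,3$, let $$z_i^{\max}=\exp\Big(\sup\{s_i : (s_1,s_2,s_3)\in\mathbb R^3,\ \operatorname{spr}A_{***}(e^{s_1},e^{s_2},e^{s_3})\le 1\}\Big).$$ Then for every $y\in\mathbb S_+$, all $x_1',x_2',x_3'\in\mathbb Z_+$ and every $j'\in S_0$, $$r_{y,(*,x_2',x_3',j')}\ge z_1^{\max},\qquad r_{y,(x_1',*,x_3',j')}\ge z_2^{\max},\qquad r_{y,(x_1',x_2',*,j')}\ge z_3^{\max},$$ where $r_{y,(*,x_2',x_3',j')}=\sup\{z\ge 0:\sum_{n=0}^\infty z^n\,\tilde q_{y,(n,x_2',x_3',j')}<\infty\}$ is the radius of convergence of the generating function of the occupation measure along the first coordinate, and the other two radii are defined in the same way along the second and third coordinates. -/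

import Mathlib

open scoped ENNReal NNReal

/-- The transition matrix of a discrete-time three-dimensional skip-free Markov modulated
random walk on `ℤ³ × S`: a stochastic matrix whose level increments lie in `{-1, 0, 1}³` and which
is invariant under translations of the level. -/
structure MMRW (S : Type*) where
  p : (Fin 3 → ℤ) × S → (Fin 3 → ℤ) × S → ℝ
  nonneg : ∀ y y', 0 ≤ p y y'
  hasSum_one : ∀ y, HasSum (fun y' => p y y') 1
  skipFree : ∀ y y', p y y' ≠ 0 → ∀ i, y'.1 i - y.1 i ∈ ({-1, 0, 1} : Finset ℤ)
  homogeneous : ∀ (k x x' : Fin 3 → ℤ) (j j' : S), p (x + k, j) (x' + k, j') = p (x, j) (x', j')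

namespace MMRW

noncomputable section

/-- The state space `ℤ₊³ × S` of the truncated walk. -/
abbrev State (S : Type*) := (Fin 3 → ℕ) × S

/-- The set `{-1, 0, 1}³`. -/
def steps : Finset (Fin 3 → ℤ) := Fintype.piFinset fun _ => {-1, 0, 1}

variable {S : Type*} (W : MMRW S)

/-- The block `A_k`. -/
def A (k : Fin 3 → ℤ) : Matrix S S ℝ := Matrix.of fun j j' => W.p (0, j) (k, j')

/-- The matrix function `A_{***}(z₁, z₂, z₃) = ∑_k z₁^{k₁} z₂^{k₂} z₃^{k₃} A_k`. -/
def Astar (z : Fin 3 → ℝ) : Matrix S S ℝ := ∑ k ∈ steps, (∏ i, z i ^ k i) • W.A k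

/-- The sum of the blocks `A_k` over all `k` with `k_i = l`; for `i = 0` this is `A_{l,*,*}`. -/
def marginal (i : Fin 3) (l : ℤ) : Matrix S S ℝ := ∑ k ∈ steps with k i = l, W.A k

/-- `π` is a stationary probability distribution of the phase process, whose transition matrix
is `A_{***} = A_{***}(1, 1, 1)`. -/
def IsStationary [Fintype S] (π : S → ℝ) : Prop :=
  π ∈ stdSimplex ℝ S ∧ Matrix.vecMul π (W.Astar 1) = π

/-- The mean drift vector. -/
def drift [Fintype S] (π : S → ℝ) (i : Fin 3) : ℝ :=
  dotProduct π (Matrix.mulVec (-W.marginal i (-1) + W.marginal i 1) 1)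

/-- The restriction `Q` of the transition matrix to `ℤ₊³ × S`. -/
def Q : Matrix (State S) (State S) ℝ :=
  Matrix.of fun y y' => W.p (fun i => (y.1 i : ℤ), y.2) (fun i => (y'.1 i : ℤ), y'.2)

/-- The powers of `Q`, computed in `[0, ∞]` since the index set is infinite. -/
def Qpow [DecidableEq S] : ℕ → State S → State S → ℝ≥0∞
  | 0, y, y' => if y = y' then 1 else 0
  | n + 1, y, y' => ∑' y'', Qpow n y y'' * ENNReal.ofReal (W.Q y'' y')

/-- The fundamental matrix `∑ₙ Qⁿ`; its rows are the occupation measures. -/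
def Qtilde [DecidableEq S] (y y' : State S) : ℝ≥0∞ := ∑' n, W.Qpow n y y'

/-- Aperiodicity of `Q`: for every state `y`, the greatest common divisor of the `n ≥ 1` with
`[Qⁿ]_{y,y} > 0` is `1`. -/
def QAperiodic [DecidableEq S] : Prop :=
  ∀ (y : State S) (d : ℕ), (∀ n, 1 ≤ n → 0 < W.Qpow n y y → d ∣ n) → d = 1

/-- The state whose `i`-th level is `n`, whose other two levels are, in order, the entries of `x`,
and whose phase is `j`. -/
def state (i : Fin 3) (n : ℕ) (x : Fin 2 → ℕ) (j : S) : State S :=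
  (Fin.insertNth (α := fun _ => ℕ) i n x, j)

/-- The block `A₁^{(i)}` of `Q`, from level `0` to level `1` of coordinate `i`, indexed by the
other two coordinates and the phase. -/
def upBlock (i : Fin 3) : Matrix ((Fin 2 → ℕ) × S) ((Fin 2 → ℕ) × S) ℝ :=
  Matrix.of fun u v => W.Q (state i 0 u.1 u.2) (state i 1 v.1 v.2)

/-- `χ(z) = spr A_{***}(z)`, the largest modulus of a complex eigenvalue. -/
def chi [Fintype S] [DecidableEq S] (z : Fin 3 → ℝ) : ℝ≥0∞ :=
  spectralRadius ℂ ((W.Astar z).map ((↑) : ℝ → ℂ))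

/-- The set `{s ∈ ℝ³ : χ(e^{s₁}, e^{s₂}, e^{s₃}) ≤ 1}`. -/
def Gamma [Fintype S] [DecidableEq S] : Set (Fin 3 → ℝ) :=
  {s | W.chi (fun i => Real.exp (s i)) ≤ 1}

/-- `s_i^max`, the supremum of `s_i` over `Gamma`, taken in the extended reals. -/
def sMax [Fintype S] [DecidableEq S] (i : Fin 3) : EReal := ⨆ s ∈ W.Gamma, ((s i : ℝ) : EReal)

/-- `z_i^max = exp(s_i^max)`. -/
def zMax [Fintype S] [DecidableEq S] (i : Fin 3) : ℝ≥0∞ := EReal.exp (W.sMax i)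

/-- The generating function along direction `i` of the occupation measure started at `y`; the
other two levels are fixed at `x` and the phase at `j`. -/
def phi [DecidableEq S] (y : State S) (i : Fin 3) (x : Fin 2 → ℕ) (j : S) (z : ℝ≥0) : ℝ≥0∞ :=
  ∑' n : ℕ, (z : ℝ≥0∞) ^ n * W.Qtilde y (state i n x j)

/-- The radius of convergence `sup {z ≥ 0 : φ(z) < ∞}`. -/
def radius [DecidableEq S] (y : State S) (i : Fin 3) (x : Fin 2 → ℕ) (j : S) : ℝ≥0∞ :=
  ⨆ z ∈ {z : ℝ≥0 | W.phi y i x j z < ∞}, (z : ℝ≥0∞)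

end

end MMRW

/-! If `A_{***}(e^t) e^g ≤ ρ e^g` with `ρ < 1`, then `e^{t·x + g_j}` is strictly superharmonic for
`Q`. A geometric series then makes its integral against every occupation measure finite, and each
radius along direction `i` is at least `e^{t_i}` (`exp_le_radius`). It remains to approach each `s ∈
Gamma` by such `t`. At `s` itself, spectral radius at most `1` gives only the factor `1 + ε`
(`exists_expMoment_le`). Nonzero drift gives one strictly contracting pair `(t₀, g₀)`
(`exists_expMoment_lt_one`). The ratio `expMoment` is jointly convex in `(t, g)`, so points of the
segment from `s` to `t₀` contract strictly once `ε` is small, and they may be taken arbitrarily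
close to `s`. -/

namespace Matrix

open Filter Topology

variable {S : Type*} [Fintype S]

attribute [local instance] Matrix.linftyOpNormedRing Matrix.linftyOpNormedAlgebra

/-! ### Finite matrices: superharmonic vectors, Poisson equation, maximum principle. -/

/-- If the spectral radius of a complex matrix is at most `1`, its powers grow subexponentially. -/
lemma exists_norm_pow_le_of_spectralRadius_le_one [DecidableEq S] (B : Matrix S S ℂ)
    (hB : spectralRadius ℂ B ≤ 1) {ε : ℝ} (hε : 0 < ε) :
    ∃ N : ℕ, 1 ≤ N ∧ ‖B ^ N‖ ≤ (1 + ε) ^ N := by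
  have hlim := spectrum.pow_norm_pow_one_div_tendsto_nhds_spectralRadius B
  have hlt : spectralRadius ℂ B < ENNReal.ofReal (1 + ε) := by
    refine hB.trans_lt ?_
    rw [← ENNReal.ofReal_one]
    exact (ENNReal.ofReal_lt_ofReal_iff (by linarith)).2 (by linarith)
  obtain ⟨N, hN, hN1⟩ := ((hlim.eventually_lt_const hlt).and (eventually_ge_atTop 1)).exists
  refine ⟨N, hN1, ?_⟩
  have hroot := (ENNReal.ofReal_lt_ofReal_iff (by linarith)).1 hN
  have hN0 : (N : ℝ) ≠ 0 := by positivity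
  calc ‖B ^ N‖ = (‖B ^ N‖ ^ (1 / N : ℝ)) ^ N := by
        rw [← Real.rpow_natCast, ← Real.rpow_mul (norm_nonneg _), one_div,
          inv_mul_cancel₀ hN0, Real.rpow_one]
    _ ≤ (1 + ε) ^ N := pow_le_pow_left₀ (by positivity) hroot.le N

/-- A nonnegative matrix of spectral radius at most `1` has, for every `ε > 0`, a strictly positive
vector that is `(1 + ε)`-superharmonic. -/
lemma exists_pos_mulVec_le_of_spectralRadius_le_one [DecidableEq S] (M : Matrix S S ℝ)
    (hM : ∀ i j, 0 ≤ M i j) (hr : spectralRadius ℂ (M.map ((↑) : ℝ → ℂ)) ≤ 1) {ε : ℝ} (hε : 0 < ε) :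
    ∃ h : S → ℝ, (∀ j, 0 < h j) ∧ ∀ j, (M *ᵥ h) j ≤ (1 + ε) * h j := by
  obtain ⟨N, hN1, hN⟩ := exists_norm_pow_le_of_spectralRadius_le_one _ hr hε
  have hc : 0 < 1 + ε := by linarith
  have hnn : ∀ n j, 0 ≤ ((M ^ n) *ᵥ (1 : S → ℝ)) j := fun n j =>
    Finset.sum_nonneg fun j' _ => mul_nonneg (pow_apply_nonneg hM n j j') zero_le_one
  have hbound : ∀ j, ((M ^ N) *ᵥ (1 : S → ℝ)) j ≤ (1 + ε) ^ N := by
    intro j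
    have hmap : (M.map ((↑) : ℝ → ℂ)) ^ N = (M ^ N).map ((↑) : ℝ → ℂ) :=
      (Matrix.map_pow M Complex.ofRealHom N).symm
    have hrow : ∑ j', ‖((M ^ N).map ((↑) : ℝ → ℂ)) j j'‖₊ ≤ ‖(M ^ N).map ((↑) : ℝ → ℂ)‖₊ := by
      rw [linfty_opNNNorm_def]
      exact Finset.le_sup (f := fun i => ∑ j', ‖((M ^ N).map ((↑) : ℝ → ℂ)) i j'‖₊)
        (Finset.mem_univ j)
    have hrow' : ∑ j', ‖((M ^ N).map ((↑) : ℝ → ℂ)) j j'‖ ≤ ‖(M ^ N).map ((↑) : ℝ → ℂ)‖ := by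
      simpa [← NNReal.coe_le_coe] using hrow
    rw [← hmap] at hrow'
    refine le_trans ?_ (hrow'.trans hN)
    rw [hmap]
    refine Finset.sum_le_sum fun j' _ => ?_
    simpa using le_abs_self _
  -- The witness is a truncated Neumann series. Applying `M` shifts it, so only the two end terms
  -- differ; the choice of `N` makes the new last term at most the lost first term `1`.
  have hstep : ∀ n : ℕ, M *ᵥ (∑ m ∈ Finset.range n, ((1 + ε) ^ m)⁻¹ • ((M ^ m) *ᵥ (1 : S → ℝ)))
      = (1 + ε) • (∑ m ∈ Finset.range n, ((1 + ε) ^ m)⁻¹ • ((M ^ m) *ᵥ (1 : S → ℝ)))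
        - (1 + ε) • (1 : S → ℝ) + (1 + ε) • (((1 + ε) ^ n)⁻¹ • ((M ^ n) *ᵥ (1 : S → ℝ))) := by
    intro n
    induction n with
    | zero => simp
    | succ n ih =>
      rw [Finset.sum_range_succ, mulVec_add, ih, mulVec_smul, mulVec_mulVec, ← pow_succ', smul_add]
      have : (1 + ε) • (((1 + ε) ^ (n + 1))⁻¹ • ((M ^ (n + 1)) *ᵥ (1 : S → ℝ)))
          = ((1 + ε) ^ n)⁻¹ • ((M ^ (n + 1)) *ᵥ (1 : S → ℝ)) := by
        rw [smul_smul]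
        congr 1
        field_simp
        ring
      rw [this]
      abel
  refine ⟨∑ m ∈ Finset.range N, ((1 + ε) ^ m)⁻¹ • ((M ^ m) *ᵥ (1 : S → ℝ)), fun j => ?_,
    fun j => ?_⟩
  · rw [Finset.sum_apply]
    refine Finset.sum_pos' (fun m _ => ?_) ⟨0, Finset.mem_range.2 hN1, ?_⟩
    · exact mul_nonneg (by positivity) (hnn m j)
    · simp
  · rw [hstep N]
    have hlast : (((1 + ε) ^ N)⁻¹ • ((M ^ N) *ᵥ (1 : S → ℝ))) j ≤ 1 := by
      rw [Pi.smul_apply, smul_eq_mul, inv_mul_le_iff₀ (by positivity), mul_one]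
      exact hbound j
    simp only [Pi.add_apply, Pi.sub_apply, Pi.smul_apply _ (∑ m ∈ Finset.range N, _), smul_eq_mul,
      Pi.smul_apply (1 + ε), Pi.one_apply]
    have := mul_le_mul_of_nonneg_left hlast hc.le
    linarith

/-- Solvability of the Poisson equation for a matrix with left-invariant vector `π ≠ 0` whose
invariant vectors are constant. -/
lemma exists_sub_mulVec_eq (P : Matrix S S ℝ) (hP : ∀ v, P *ᵥ v = v → ∀ i j, v i = v j)
    {π : S → ℝ} (hπ : π ≠ 0) (hπP : π ᵥ* P = π) {b : S → ℝ} (hb : π ⬝ᵥ b = 0) :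
    ∃ g : S → ℝ, g - P *ᵥ g = b := by
  let L : (S → ℝ) →ₗ[ℝ] (S → ℝ) := LinearMap.id - P.mulVecLin
  let φ : (S → ℝ) →ₗ[ℝ] ℝ :=
    { toFun := fun v => π ⬝ᵥ v
      map_add' := fun v w => dotProduct_add π v w
      map_smul' := fun c v => by simp [dotProduct_smul] }
  have hle : LinearMap.range L ≤ LinearMap.ker φ := by
    rintro _ ⟨v, rfl⟩
    change π ⬝ᵥ (v - P *ᵥ v) = 0
    rw [dotProduct_sub, dotProduct_mulVec, hπP, sub_self]
  have hkerL : Module.finrank ℝ (LinearMap.ker L) ≤ 1 := by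
    have hsub : LinearMap.ker L ≤ Submodule.span ℝ {(1 : S → ℝ)} := by
      intro v hv
      have hv' : P *ᵥ v = v := (sub_eq_zero.1 (show v - P *ᵥ v = 0 from hv)).symm
      rw [Submodule.mem_span_singleton]
      obtain ⟨i, -⟩ := Function.ne_iff.1 hπ
      exact ⟨v i, funext fun j => by simpa using hP v hv' i j⟩
    exact (Submodule.finrank_mono hsub).trans
      ((finrank_span_le_card _).trans (by simp))
  have hrangeφ : Module.finrank ℝ (LinearMap.range φ) = 1 := by
    have hφ : φ ≠ 0 := by
      intro h
      refine hπ (dotProduct_self_eq_zero.1 ?_)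
      exact LinearMap.congr_fun h π
    rw [LinearMap.range_eq_top.2 (LinearMap.surjective hφ), finrank_top, Module.finrank_self]
  have h1 := L.finrank_range_add_finrank_ker
  have h2 := φ.finrank_range_add_finrank_ker
  -- Rank-nullity: the range of `L` has codimension at most `1` and lies in the hyperplane `ker φ`.
  have heq := Submodule.eq_of_le_of_finrank_le hle (by omega)
  have hbm : b ∈ LinearMap.range L := by
    rw [heq]
    exact hb
  obtain ⟨g, hg⟩ := hbm
  exact ⟨g, hg⟩

/-- The maximum principle: an invariant vector of a stochastic matrix attaining its maximum at `i`
takes the same value at every `j` with a positive transition from `i`. -/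
lemma eq_of_mulVec_eq_of_pos {P : Matrix S S ℝ} (hP : ∀ i j, 0 ≤ P i j) (hP1 : P *ᵥ 1 = 1)
    {v : S → ℝ} (hv : P *ᵥ v = v) {i j : S} (hmax : ∀ k, v k ≤ v i) (hij : 0 < P i j) :
    v j = v i := by
  have hsum : ∑ k, P i k * (v i - v k) = 0 := by
    have e1 : ∑ k, P i k = 1 := by simpa [mulVec, dotProduct] using congrFun hP1 i
    have e2 : ∑ k, P i k * v k = v i := congrFun hv i
    simp only [mul_sub, Finset.sum_sub_distrib, ← Finset.sum_mul, e1, e2]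
    ring
  have := (Finset.sum_eq_zero_iff_of_nonneg
    (fun k _ => mul_nonneg (hP i k) (sub_nonneg.2 (hmax k)))).1 hsum j (Finset.mem_univ j)
  rcases mul_eq_zero.1 this with h | h
  · exact absurd h hij.ne'
  · linarith

end Matrix

namespace MMRW

open Filter Topology Matrix

variable {S : Type*} (W : MMRW S)

/-! ### Blocks of the walk and the phase chain. -/

lemma mem_steps {k : Fin 3 → ℤ} : k ∈ steps ↔ ∀ i, k i ∈ ({-1, 0, 1} : Finset ℤ) := by
  simp [steps, Fintype.mem_piFinset]

lemma A_nonneg (k : Fin 3 → ℤ) (j j' : S) : 0 ≤ W.A k j j' := W.nonneg _ _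

lemma A_eq_zero_of_notMem {k : Fin 3 → ℤ} (hk : k ∉ steps) (j j' : S) : W.A k j j' = 0 := by
  by_contra h
  exact hk (mem_steps.2 fun i => by simpa using W.skipFree (0, j) (k, j') h i)

lemma p_eq_A (x k : Fin 3 → ℤ) (j j' : S) : W.p (x, j) (k + x, j') = W.A k j j' := by
  simpa [A] using W.homogeneous x 0 k j j'

lemma Astar_apply (z : Fin 3 → ℝ) (j j' : S) :
    W.Astar z j j' = ∑ k ∈ steps, (∏ i, z i ^ k i) * W.A k j j' := by
  simp [Astar, Matrix.sum_apply]

lemma Astar_one_apply (j j' : S) : W.Astar 1 j j' = ∑ k ∈ steps, W.A k j j' := by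
  simp [Astar_apply]

lemma Astar_one_nonneg (j j' : S) : 0 ≤ W.Astar 1 j j' := by
  rw [Astar_one_apply]
  exact Finset.sum_nonneg fun k _ => W.A_nonneg k j j'

/-- The embedding of `ℤ₊³ × S` into `ℤ³ × S`. -/
def State.toInt (y : State S) : (Fin 3 → ℤ) × S := (fun i => (y.1 i : ℤ), y.2)

lemma State.toInt_injective : Function.Injective (State.toInt (S := S)) := by
  rintro ⟨x, j⟩ ⟨x', j'⟩ h
  simp only [State.toInt, Prod.mk.injEq, funext_iff, Nat.cast_inj] at h
  exact Prod.ext (funext h.1) h.2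

/-- The exponential function `(x, j) ↦ e^{t·x + g_j}`. -/
noncomputable def expFun (t : Fin 3 → ℝ) (g : S → ℝ) (y : (Fin 3 → ℤ) × S) : ℝ≥0∞ :=
  ENNReal.ofReal (Real.exp (∑ i, t i * y.1 i + g y.2))

variable [Fintype S]

lemma sum_A_eq_one (j : S) : ∑ k ∈ steps, ∑ j', W.A k j j' = 1 := by
  rw [← Finset.sum_product' steps Finset.univ (fun k j' => W.A k j j')]
  refine (hasSum_sum_of_ne_finset_zero fun y hy => ?_).unique (W.hasSum_one (0, j))
  exact W.A_eq_zero_of_notMem (fun h => hy (by simp [h])) j y.2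

lemma Astar_one_mulVec_one : W.Astar 1 *ᵥ 1 = 1 := by
  ext j
  simp only [mulVec, dotProduct, Astar_one_apply, Pi.one_apply, mul_one]
  rw [Finset.sum_comm, W.sum_A_eq_one]

/-- Irreducibility of `Q` passes to the phase process: its invariant vectors are constant. -/
lemma eq_of_Astar_one_mulVec_eq (hirr : W.Q.IsIrreducible) {v : S → ℝ}
    (hv : W.Astar 1 *ᵥ v = v) (i j : S) : v i = v j := by
  classical
  have : Nonempty S := ⟨i⟩
  obtain ⟨m, hm⟩ := Finite.exists_max v
  have key : ∀ y : State S, v y.2 = v m := by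
    intro y
    let := W.Q.toQuiver
    obtain ⟨path, -⟩ := hirr.connected ((0, m) : State S) y
    -- The maximum of `v` propagates along a path of `Q`, since each transition of `Q` projects to a
    -- positive phase transition.
    induction path with
    | nil => rfl
    | @cons b c q e ih =>
      have he : 0 < W.Q b c := e.down
      set k : Fin 3 → ℤ := fun i => (c.1 i : ℤ) - b.1 i with hk
      have hA : 0 < W.A k b.2 c.2 := by
        rw [← W.p_eq_A (fun i => (b.1 i : ℤ)) k]
        convert he using 1
        rw [Q, Matrix.of_apply]
        congr 2
        ext i
        simp [hk]
      have hmem : k ∈ steps := by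
        by_contra h
        exact hA.ne' (W.A_eq_zero_of_notMem h _ _)
      have hP : 0 < W.Astar 1 b.2 c.2 := by
        rw [Astar_one_apply]
        exact Finset.sum_pos' (fun k _ => W.A_nonneg k _ _) ⟨k, hmem, hA⟩
      rw [← ih]
      exact eq_of_mulVec_eq_of_pos W.Astar_one_nonneg W.Astar_one_mulVec_one hv
        (fun k => (hm k).trans ih.ge) hP
  rw [key (0, i), key (0, j)]

/-! ### Exponential moments: convexity, and strict contraction from the drift. -/

/-- The ratio `(A_{***}(e^t) e^g)_j / e^{g_j}`, a convex function of `(t, g)`. -/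
noncomputable def expMoment (t : Fin 3 → ℝ) (g : S → ℝ) (j : S) : ℝ :=
  ∑ k ∈ steps, ∑ j', Real.exp (∑ i, t i * k i + (g j' - g j)) * W.A k j j'

/-- Each summand is a nonnegative weight times the exponential of a form linear in `(t, g)`; this is
why positive vectors are written as `e^g`. -/
lemma expMoment_convexComb_le {t t' : Fin 3 → ℝ} {g g' : S → ℝ} {a b : ℝ} (ha : 0 ≤ a)
    (hb : 0 ≤ b) (hab : a + b = 1) (j : S) :
    W.expMoment (a • t + b • t') (a • g + b • g') j
      ≤ a * W.expMoment t g j + b * W.expMoment t' g' j := by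
  simp only [expMoment, Finset.mul_sum]
  simp only [← Finset.sum_add_distrib]
  refine Finset.sum_le_sum fun k _ => Finset.sum_le_sum fun j' _ => ?_
  have h := convexOn_exp.2 (Set.mem_univ (∑ i, t i * k i + (g j' - g j)))
    (Set.mem_univ (∑ i, t' i * k i + (g' j' - g' j))) ha hb hab
  have e : ∑ i, (a • t + b • t') i * k i + ((a • g + b • g') j' - (a • g + b • g') j)
      = a • (∑ i, t i * k i + (g j' - g j)) + b • (∑ i, t' i * k i + (g' j' - g' j)) := by
    simp only [Pi.add_apply, Pi.smul_apply, smul_eq_mul, Fin.sum_univ_three]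
    ring
  rw [e]
  calc _ ≤ _ := mul_le_mul_of_nonneg_right h (W.A_nonneg k j j')
    _ = _ := by simp only [smul_eq_mul]; ring

lemma exists_expMoment_le [DecidableEq S] {s : Fin 3 → ℝ} (hs : s ∈ W.Gamma) {ε : ℝ}
    (hε : 0 < ε) : ∃ g : S → ℝ, ∀ j, W.expMoment s g j ≤ 1 + ε := by
  have hprod : ∀ k : Fin 3 → ℤ, ∏ i, Real.exp (s i) ^ k i = Real.exp (∑ i, s i * k i) := by
    intro k
    rw [Real.exp_sum]
    refine Finset.prod_congr rfl fun i _ => ?_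
    rw [← Real.rpow_intCast, ← Real.exp_mul]
  obtain ⟨h, hpos, hle⟩ := exists_pos_mulVec_le_of_spectralRadius_le_one
    (W.Astar fun i => Real.exp (s i)) (fun i j => by
      rw [Astar_apply]
      exact Finset.sum_nonneg fun k _ => mul_nonneg (by positivity) (W.A_nonneg k i j)) hs hε
  refine ⟨fun j => Real.log (h j), fun j => ?_⟩
  have heq : W.expMoment s (fun j => Real.log (h j)) j
      = ((W.Astar fun i => Real.exp (s i)) *ᵥ h) j / h j := by
    simp only [expMoment, mulVec, dotProduct, Astar_apply, Finset.sum_mul, Finset.sum_div, hprod]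
    rw [Finset.sum_comm]
    refine Finset.sum_congr rfl fun j' _ => Finset.sum_congr rfl fun k _ => ?_
    rw [Real.exp_add, Real.exp_sub, Real.exp_log (hpos j'), Real.exp_log (hpos j)]
    ring
  rw [heq, div_le_iff₀ (hpos j)]
  exact hle j

/-- The drift is the stationary mean of the one-step level increment. -/
lemma drift_eq (π : S → ℝ) (i : Fin 3) :
    W.drift π i = π ⬝ᵥ fun j => ∑ k ∈ steps, ∑ j', (k i : ℝ) * W.A k j j' := by
  unfold drift
  congr 1
  ext j
  simp only [mulVec, dotProduct, marginal, Matrix.add_apply, Matrix.neg_apply, Matrix.sum_apply,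
    Pi.one_apply, mul_one, Finset.sum_filter]
  rw [Finset.sum_comm]
  refine Finset.sum_congr rfl fun j' _ => ?_
  rw [← Finset.sum_neg_distrib, ← Finset.sum_add_distrib]
  refine Finset.sum_congr rfl fun k hk => ?_
  have := mem_steps.1 hk i
  simp only [Finset.mem_insert, Finset.mem_singleton] at this
  rcases this with h | h | h <;> simp [h]

/-- A nonzero drift component yields a point where `A_{***}` strictly contracts a positive
vector. -/
lemma exists_expMoment_lt_one [DecidableEq S] {π : S → ℝ} (hπ : W.IsStationary π)
    (hirr : W.Q.IsIrreducible) {i : Fin 3} (hi : W.drift π i ≠ 0) :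
    ∃ (t : Fin 3 → ℝ) (g : S → ℝ), ∀ j, W.expMoment t g j < 1 := by
  set a := W.drift π i with ha
  set b : S → ℝ := fun j => ∑ k ∈ steps, ∑ j', (k i : ℝ) * W.A k j j' with hb
  have hπ1 : ∑ j, π j = 1 := hπ.1.2
  have hπ0 : π ≠ 0 := by
    rintro rfl
    simp at hπ1
  -- Subtracting `a` makes the increment `π`-centred; the corrector `g` then equalises the mean
  -- increment over all phases.
  obtain ⟨g, hg⟩ := exists_sub_mulVec_eq (W.Astar 1)
    (fun v hv => W.eq_of_Astar_one_mulVec_eq hirr hv) hπ0 hπ.2 (b := b - a • 1) (by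
      rw [dotProduct_sub, dotProduct_smul, dotProduct_one, hπ1, ha, drift_eq]
      simp [hb])
  -- Moving from the origin against the drift, along `-a (e_i, g)`, every phase has the same
  -- derivative `-a²`.
  let c : (Fin 3 → ℤ) → S → S → ℝ := fun k j j' => -a * (k i + (g j' - g j))
  let F : S → ℝ → ℝ := fun j r => ∑ k ∈ steps, ∑ j', Real.exp (r * c k j j') * W.A k j j'
  have hF0 : ∀ j, F j 0 = 1 := fun j => by simp [F, W.sum_A_eq_one]
  have hderiv : ∀ j, HasDerivAt (F j) (-(a * a)) 0 := by
    intro j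
    have hval : ∑ k ∈ steps, ∑ j', c k j j' * W.A k j j' = -(a * a) := by
      have h1 : ∑ k ∈ steps, ∑ j', c k j j' * W.A k j j'
          = -a * (b j + (W.Astar 1 *ᵥ g) j - g j * ∑ k ∈ steps, ∑ j', W.A k j j') := by
        have h2 : (W.Astar 1 *ᵥ g) j = ∑ k ∈ steps, ∑ j', W.A k j j' * g j' := by
          simp only [mulVec, dotProduct, Astar_one_apply, Finset.sum_mul]
          rw [Finset.sum_comm]
        rw [h2, hb]
        simp only [Finset.mul_sum, ← Finset.sum_add_distrib, ← Finset.sum_sub_distrib]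
        refine Finset.sum_congr rfl fun k _ => Finset.sum_congr rfl fun j' _ => ?_
        simp only [c]
        ring
      have h3 : g j - (W.Astar 1 *ᵥ g) j = b j - a := by simpa using congrFun hg j
      rw [h1, W.sum_A_eq_one]
      linear_combination a * h3
    rw [← hval]
    refine HasDerivAt.fun_sum fun k _ => HasDerivAt.fun_sum fun j' _ => ?_
    have := (((hasDerivAt_id (0 : ℝ)).mul_const (c k j j')).exp).mul_const (W.A k j j')
    simpa using this
  have hev : ∀ᶠ r in 𝓝[>] (0 : ℝ), ∀ j, F j r < 1 := by
    rw [eventually_all]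
    intro j
    have hslope := (hasDerivAt_iff_tendsto_slope.1 (hderiv j)).mono_left
      (nhdsWithin_mono 0 fun r (hr : 0 < r) => hr.ne')
    have hneg : -(a * a) < 0 := neg_lt_zero.2 (mul_self_pos.2 hi)
    filter_upwards [hslope.eventually_lt_const hneg, self_mem_nhdsWithin] with r hr hr0
    rw [slope_def_field, hF0, sub_zero, div_lt_iff₀ hr0] at hr
    linarith
  obtain ⟨r, hr⟩ := hev.exists
  refine ⟨Pi.single i (r * -a), (r * -a) • g, fun j => ?_⟩
  convert hr j using 1
  refine Finset.sum_congr rfl fun k _ => Finset.sum_congr rfl fun j' _ => ?_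
  congr 2
  rw [Finset.sum_eq_single i (by intro l _ hl; simp [hl]) (by simp)]
  simp only [Pi.single_eq_same, Pi.smul_apply, smul_eq_mul, c]
  ring

/-! ### Superharmonic exponentials and convergence of the generating functions. -/

lemma tsum_p_mul_expFun (t : Fin 3 → ℝ) (g : S → ℝ) (y : (Fin 3 → ℤ) × S) :
    ∑' y', ENNReal.ofReal (W.p y y') * expFun t g y'
      = ENNReal.ofReal (W.expMoment t g y.2) * expFun t g y := by
  obtain ⟨x, j⟩ := y
  rw [← ((Equiv.addRight x).prodCongr (Equiv.refl S)).tsum_eq,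
    tsum_eq_sum (s := steps ×ˢ Finset.univ)]
  · rw [Finset.sum_product, expMoment, expFun, ← ENNReal.ofReal_mul
      (Finset.sum_nonneg fun k _ => Finset.sum_nonneg fun j' _ =>
        mul_nonneg (Real.exp_pos _).le (W.A_nonneg k j j')), Finset.sum_mul,
      ENNReal.ofReal_sum_of_nonneg fun k _ => mul_nonneg (Finset.sum_nonneg fun j' _ =>
        mul_nonneg (Real.exp_pos _).le (W.A_nonneg k j j')) (Real.exp_pos _).le]
    refine Finset.sum_congr rfl fun k _ => ?_
    rw [Finset.sum_mul, ENNReal.ofReal_sum_of_nonneg fun j' _ =>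
        mul_nonneg (mul_nonneg (Real.exp_pos _).le (W.A_nonneg k j j')) (Real.exp_pos _).le]
    refine Finset.sum_congr rfl fun j' _ => ?_
    simp only [Equiv.prodCongr_apply, Prod.map_apply, Equiv.coe_addRight, Equiv.refl_apply, expFun,
      W.p_eq_A]
    rw [← ENNReal.ofReal_mul (W.A_nonneg k j j'), mul_right_comm, ← Real.exp_add, mul_comm]
    congr 3
    simp only [Pi.add_apply, Int.cast_add, Fin.sum_univ_three]
    ring
  · rintro ⟨k, j'⟩ hk
    simp only [Equiv.prodCongr_apply, Prod.map_apply, Equiv.coe_addRight, Equiv.refl_apply,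
      W.p_eq_A]
    rw [W.A_eq_zero_of_notMem (fun h => hk (by simp [h]))]
    simp

variable [DecidableEq S]

lemma tsum_Qpow_mul_expFun_le {t : Fin 3 → ℝ} {g : S → ℝ} {ρ : ℝ≥0∞}
    (hρ : ∀ j, ENNReal.ofReal (W.expMoment t g j) ≤ ρ) (n : ℕ) (y : State S) :
    ∑' y', W.Qpow n y y' * expFun t g y'.toInt ≤ ρ ^ n * expFun t g y.toInt := by
  induction n with
  | zero => simp [Qpow, ite_mul]
  | succ n ih =>
    -- Truncation to the orthant only discards nonnegative terms.
    have hQ : ∀ z : State S, ∑' y', ENNReal.ofReal (W.Q z y') * expFun t g y'.toInt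
        ≤ ρ * expFun t g z.toInt := fun z =>
      calc _ ≤ ∑' y', ENNReal.ofReal (W.p z.toInt y') * expFun t g y' :=
            ENNReal.tsum_comp_le_tsum_of_injective State.toInt_injective
              fun y' => ENNReal.ofReal (W.p z.toInt y') * expFun t g y'
        _ ≤ _ := by
            rw [tsum_p_mul_expFun]
            gcongr
            exact hρ _
    calc ∑' y', W.Qpow (n + 1) y y' * expFun t g y'.toInt
        = ∑' z, W.Qpow n y z * ∑' y', ENNReal.ofReal (W.Q z y') * expFun t g y'.toInt := by
          simp only [Qpow, ← ENNReal.tsum_mul_right, ← ENNReal.tsum_mul_left]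
          rw [ENNReal.tsum_comm]
          simp only [mul_assoc]
      _ ≤ ∑' z, ρ * (W.Qpow n y z * expFun t g z.toInt) := by
          refine ENNReal.tsum_le_tsum fun z => ?_
          rw [mul_left_comm ρ]
          gcongr
          exact hQ z
      _ ≤ ρ ^ (n + 1) * expFun t g y.toInt := by
          rw [ENNReal.tsum_mul_left, pow_succ', mul_assoc]
          gcongr

lemma tsum_Qtilde_mul_expFun_lt_top {t : Fin 3 → ℝ} {g : S → ℝ}
    (h : ∀ j, W.expMoment t g j < 1) (y : State S) :
    ∑' y', W.Qtilde y y' * expFun t g y'.toInt < ∞ := by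
  have : Nonempty S := ⟨y.2⟩
  obtain ⟨m, hm⟩ := Finite.exists_max (W.expMoment t g)
  set ρ := ENNReal.ofReal (W.expMoment t g m) with hρ
  have hρ1 : ρ < 1 := ENNReal.ofReal_lt_one.2 (h m)
  calc ∑' y', W.Qtilde y y' * expFun t g y'.toInt
      = ∑' n, ∑' y', W.Qpow n y y' * expFun t g y'.toInt := by
        simp only [Qtilde, ← ENNReal.tsum_mul_right]
        rw [ENNReal.tsum_comm]
    _ ≤ ∑' n, ρ ^ n * expFun t g y.toInt := ENNReal.tsum_le_tsum fun n =>
        W.tsum_Qpow_mul_expFun_le (fun j => ENNReal.ofReal_le_ofReal (hm j)) n y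
    _ = (1 - ρ)⁻¹ * expFun t g y.toInt := by rw [ENNReal.tsum_mul_right, ENNReal.tsum_geometric]
    _ < ∞ := ENNReal.mul_lt_top (ENNReal.inv_lt_top.2 (tsub_pos_of_lt hρ1)) ENNReal.ofReal_lt_top

/-- Where `A_{***}(e^t)` strictly contracts a positive vector, the generating function along
direction `i` converges at `e^{t_i}`. -/
lemma exp_le_radius {t : Fin 3 → ℝ} {g : S → ℝ} (h : ∀ j, W.expMoment t g j < 1) (y : State S)
    (i : Fin 3) (x : Fin 2 → ℕ) (j : S) :
    ENNReal.ofReal (Real.exp (t i)) ≤ W.radius y i x j := by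
  set c : ℝ := ∑ l, t (i.succAbove l) * x l + g j with hc
  have hfun : ∀ n : ℕ, expFun t g (state i n x j).toInt
      = ENNReal.ofReal (Real.exp (t i)) ^ n * ENNReal.ofReal (Real.exp c) := by
    intro n
    rw [expFun, ← ENNReal.ofReal_pow (Real.exp_pos _).le, ← ENNReal.ofReal_mul (by positivity),
      ← Real.exp_nat_mul, ← Real.exp_add]
    congr 2
    simp only [State.toInt, state, Fin.sum_univ_succAbove _ i, Fin.insertNth_apply_same,
      Fin.insertNth_apply_succAbove, Int.cast_natCast, hc]
    ring
  have hinj : Function.Injective fun n : ℕ => state i n x j := by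
    intro n m hnm
    simpa [state] using congrFun (congrArg Prod.fst hnm) i
  have hfin : (∑' n : ℕ, ENNReal.ofReal (Real.exp (t i)) ^ n * W.Qtilde y (state i n x j))
      * ENNReal.ofReal (Real.exp c) < ∞ := by
    refine lt_of_le_of_lt ?_ (W.tsum_Qtilde_mul_expFun_lt_top h y)
    refine le_trans (le_of_eq ?_) (ENNReal.tsum_comp_le_tsum_of_injective hinj
      fun y' => W.Qtilde y y' * expFun t g y'.toInt)
    rw [← ENNReal.tsum_mul_right]
    refine tsum_congr fun n => ?_
    rw [hfun]
    ring
  have hphi : W.phi y i x j (Real.exp (t i)).toNNReal < ∞ :=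
    ENNReal.lt_top_of_mul_ne_top_left hfin.ne (by simp [Real.exp_pos])
  exact le_iSup₂ (f := fun (z : ℝ≥0) (_ : z ∈ {z : ℝ≥0 | W.phi y i x j z < ∞}) => (z : ℝ≥0∞))
    _ hphi

lemma exp_le_radius_of_mem_Gamma {t₀ : Fin 3 → ℝ} {g₀ : S → ℝ} (h₀ : ∀ j, W.expMoment t₀ g₀ j < 1)
    {s : Fin 3 → ℝ} (hs : s ∈ W.Gamma) (y : State S) (i : Fin 3) (x : Fin 2 → ℕ) (j : S) :
    ENNReal.ofReal (Real.exp (s i)) ≤ W.radius y i x j := by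
  have hlim : Tendsto (fun δ : ℝ => ENNReal.ofReal (Real.exp (((1 - δ) • s + δ • t₀) i)))
      (𝓝[>] 0) (𝓝 (ENNReal.ofReal (Real.exp (s i)))) := by
    have hcont : Continuous fun δ : ℝ =>
        ENNReal.ofReal (Real.exp (((1 - δ) • s + δ • t₀) i)) := by
      simp only [Pi.add_apply, Pi.smul_apply, smul_eq_mul]
      exact ENNReal.continuous_ofReal.comp (by fun_prop)
    simpa using (hcont.tendsto 0).mono_left nhdsWithin_le_nhds
  refine le_of_tendsto hlim ?_
  filter_upwards [Ioo_mem_nhdsGT (zero_lt_one' ℝ)] with δ hδ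
  have : Nonempty S := ⟨y.2⟩
  obtain ⟨m, hm⟩ := Finite.exists_max (W.expMoment t₀ g₀)
  -- With `η = 1 - max_j expMoment t₀ g₀ j` and `ε = δη`, convexity gives `(1 - δ)(1 + δη) + δ(1 -
  -- η) = 1 - δ²η < 1`.
  obtain ⟨g, hg⟩ := W.exists_expMoment_le hs
    (ε := δ * (1 - W.expMoment t₀ g₀ m)) (mul_pos hδ.1 (by linarith [h₀ m]))
  refine W.exp_le_radius (t := (1 - δ) • s + δ • t₀) (g := (1 - δ) • g + δ • g₀) (fun l => ?_)
    y i x j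
  have hconv := W.expMoment_convexComb_le (t := s) (t' := t₀) (g := g) (g' := g₀)
    (sub_nonneg.2 hδ.2.le) hδ.1.le (by ring) l
  have e1 := mul_le_mul_of_nonneg_left (hg l) (sub_nonneg.2 hδ.2.le)
  have e2 := mul_le_mul_of_nonneg_left (hm l) hδ.1.le
  have e3 : 0 < δ * δ * (1 - W.expMoment t₀ g₀ m) :=
    mul_pos (mul_pos hδ.1 hδ.1) (by linarith [h₀ m])
  nlinarith

end MMRW

theorem mainTheorem1 {S : Type*} [Fintype S] [DecidableEq S] (W : MMRW S)
    (π : S → ℝ) (hπ : W.IsStationary π)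
    (hdrift : ∀ i, W.drift π i ≠ 0) (hneg : ∃ i, W.drift π i < 0)
    (hirr : W.Q.IsIrreducible) (haper : W.QAperiodic)
    (hpos : ∀ (i : Fin 3) (u : (Fin 2 → ℕ) × S), ∃ v, 0 < W.upBlock i u v)
    (y : MMRW.State S) (i : Fin 3) (x' : Fin 2 → ℕ) (j' : S) :
    W.zMax i ≤ W.radius y i x' j' := by
  obtain ⟨t₀, g₀, h₀⟩ := W.exists_expMoment_lt_one hπ hirr (hdrift i)
  rw [MMRW.zMax, ← ENNReal.exp_log (W.radius y i x' j'), EReal.exp_le_exp_iff, MMRW.sMax]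
  refine iSup₂_le fun s hs => ?_
  rw [← EReal.exp_le_exp_iff, ENNReal.exp_log, EReal.exp_coe]
  exact W.exp_le_radius_of_mem_Gamma h₀ hs y i x' j'
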